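/- Let $\mathbb K$ be $\mathbb R$ or $\mathbb C$, and let $X=\{x_1,\dots,x_m\}$ and $Y=\{y_1,\dots,y_n\}$ be finite sets with $|X|=m\ge 1$ and $|Y|=n\ge 1$. A subset $S\subseteq X\times Y$ is called good if for every function $f:S\to\mathbb K$ there are functions $u:X\to\mathbb K$ and $v:Y\to\mathbb K$ with $f(x,y)=u(x)+v(y)$ for all $(x,y)\in S$. A good set is called maximal if it is not properly contained in another good subset of $X\times Y$. Then the following hold (with the convention $0^0=1$). (i) The number of maximal good subsets of $X\times Y$ is $m^{n-1}n^{m-1}$, and this equals the number of spanning trees of the complete bipartite graph $K_{m,n}$ with parts $X$ and $Y$. (ii) For every $x\in X$, every $1\le k\le n$ and every $J\subseteq Y$ with $|J|=k$, the number of maximal good subsets $S$ of $X\times Y$ with $S\cap(\{x\}\times Y)=\{x\}\times J$ is $k\,n^{m-2}(m-1)^{n-k}$. (iii) For every $y\in Y$, every $1\le k\le m$ and every $I\subseteq X$ with $|I|=k$, the number of maximal good subsets $S$ of $X\times Y$ with $S\cap(X\times\{y\})=I\times\{y\}$ is $k\,m^{n-2}(n-1)^{m-k}$. -/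

import Mathlib

/-- A set `S ⊆ X × Y` is good (over `𝕜 = ℝ` or `ℂ`) if every `𝕜`-valued function `f` on `S` has the
form `f (x, y) = u x + v y` for all `(x, y) ∈ S`, for some functions `u` on `X` and `v` on `Y`. -/
def IsGood (𝕜 : Type*) [RCLike 𝕜] {X Y : Type*} (S : Set (X × Y)) : Prop :=
  ∀ f : S → 𝕜, ∃ (u : X → 𝕜) (v : Y → 𝕜), ∀ p : S, f p = u p.1.1 + v p.1.2

/-- A good set which is maximal, with respect to inclusion, among the good subsets of `X × Y`. -/
def IsMaximalGood (𝕜 : Type*) [RCLike 𝕜] {X Y : Type*} (S : Set (X × Y)) : Prop :=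
  Maximal (IsGood 𝕜) S

/-- `T` is a spanning tree of `G`: a subgraph of `G` on all the vertices of `G` that is a tree. -/
def IsSpanningTree {V : Type*} (G T : SimpleGraph V) : Prop :=
  T ≤ G ∧ T.IsTree

/-!
The count rests on a linear system. For `S ⊆ A × B` and a set `J ⊆ B` of roots, call `S` rooted at
`J` if for every right-hand side `f` the equations `u x + v y = f x y` for `(x, y) ∈ S`, together
with `v y = 0` for `y ∈ J`, have exactly one solution `(u, v)`; in graph terms, `S` is a spanning
forest each of whose components contains exactly one vertex of `J`. A good set is maximal exactly
when it is rooted at `{y₀}`, for any `y₀ : Y`, provided `X ≠ ∅` (`isMaximalGood_iff_isRooted`).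

Rooted sets are counted layer by layer. If `S` is rooted at `J`, then every `x : A` has at most one
neighbour in `J`, which gives a function `g : A → Option J`. For a fixed `g` the system is block
triangular: `S` is rooted at `J` if and only if what remains of `S` on `Jᶜ × A`, with the sides
exchanged, is rooted at the support of `g` (`isRooted_iff_isRooted_remainder`). This recursion is
solved by `|B| * #{S rooted at J} = |J| * |B| ^ |A| * |A| ^ (|B| - |J|)`
(`card_mul_rootedCount`): in the induction step the sum over `g` factors as a product over `A`.
Prescribing the neighbours of one vertex `y` is the same as prescribing `g` for `J = {y}`, so a
single step of the recursion also gives the refined counts.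

As for spanning trees, uniqueness in the linear system rooted at `{y₀}` says that the bipartite
graph of `S` is connected, and existence then amounts to `|S| + 1 = |X| + |Y|`, by comparing
dimensions; together these characterise trees.
-/

/-! ### Rooted sets and maximal good sets -/

/-- `S ⊆ A × B` is rooted at `J ⊆ B` over `𝕜` if the linear system `u x + v y = f x y` for
`(x, y) ∈ S`, `v y = 0` for `y ∈ J`, has exactly one solution `(u, v)` for each `f`. The values of
`f` off `S` play no role. Existence and uniqueness are kept as separate fields. -/
structure IsRooted (𝕜 : Type*) [Field 𝕜] {A B : Type*} (S : Set (A × B)) (J : Set B) : Prop where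
  exists_sol : ∀ f : A → B → 𝕜, ∃ (u : A → 𝕜) (v : B → 𝕜), (∀ y ∈ J, v y = 0) ∧
    ∀ x y, (x, y) ∈ S → u x + v y = f x y
  eq_zero : ∀ (u : A → 𝕜) (v : B → 𝕜), (∀ y ∈ J, v y = 0) →
    (∀ x y, (x, y) ∈ S → u x + v y = 0) → u = 0 ∧ v = 0

/-- A good set is described by right-hand sides on all of `X × Y`, and by solutions normalised to
vanish at a given `y₀`. -/
theorem isGood_iff {𝕜 : Type*} [RCLike 𝕜] {X Y : Type*} (S : Set (X × Y)) (y₀ : Y) :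
    IsGood 𝕜 S ↔ ∀ f : X → Y → 𝕜, ∃ (u : X → 𝕜) (v : Y → 𝕜), (∀ y ∈ ({y₀} : Set Y), v y = 0) ∧
      ∀ x y, (x, y) ∈ S → u x + v y = f x y := by
  classical
  constructor
  · intro h f
    obtain ⟨u, v, huv⟩ := h fun p => f p.1.1 p.1.2
    refine ⟨fun x => u x + v y₀, fun y => v y - v y₀, by simp, fun x y hxy => ?_⟩
    have := huv ⟨(x, y), hxy⟩
    simp only at this
    rw [this]
    ring
  · intro h f
    obtain ⟨u, v, -, huv⟩ := h fun x y => if hxy : (x, y) ∈ S then f ⟨(x, y), hxy⟩ else 0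
    refine ⟨u, v, fun p => ?_⟩
    have := huv p.1.1 p.1.2 p.2
    rw [this, dif_pos]

theorem isMaximalGood_iff_isRooted {𝕜 : Type*} [RCLike 𝕜] {X Y : Type*} [Nonempty X]
    (S : Set (X × Y)) (y₀ : Y) : IsMaximalGood 𝕜 S ↔ IsRooted 𝕜 S {y₀} := by
  classical
  constructor
  · intro h
    have hS := (isGood_iff S y₀).1 h.prop
    refine ⟨hS, fun u v hv huv => ?_⟩
    -- A pair on which a kernel element `(u, v)` does not vanish could be added to `S`.
    have key : ∀ x y, u x + v y = 0 := by
      intro a b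
      by_contra hab
      have hgood : IsGood 𝕜 (insert (a, b) S) := by
        rw [isGood_iff _ y₀]
        intro f
        obtain ⟨u', v', hv', h'⟩ := hS f
        set c := (f a b - u' a - v' b) / (u a + v b)
        have hcab : c * (u a + v b) = f a b - u' a - v' b := div_mul_cancel₀ _ hab
        refine ⟨fun x => u' x + c * u x, fun y => v' y + c * v y, fun y hy => ?_,
          fun x y hxy => ?_⟩
        · simp [hv y hy, hv' y hy]
        · rcases hxy with hxy | hxy
          · obtain ⟨rfl, rfl⟩ := Prod.mk.inj hxy
            linear_combination hcab
          · linear_combination h' x y hxy + c * huv x y hxy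
      exact hab (huv a b (h.le_of_ge hgood (Set.subset_insert _ _) (Set.mem_insert _ _)))
    have hu : u = 0 := by
      funext x
      simpa [hv y₀ rfl] using key x y₀
    refine ⟨hu, ?_⟩
    funext y
    simpa [hu] using key (Classical.arbitrary X) y
  · intro h
    refine ⟨(isGood_iff S y₀).2 h.exists_sol, fun T hT hST p hp => ?_⟩
    by_contra hpS
    obtain ⟨u, v, hv, huv⟩ := (isGood_iff T y₀).1 hT fun x y => if (x, y) = p then 1 else 0
    obtain ⟨rfl, rfl⟩ := h.eq_zero u v hv fun x y hxy => by
      rw [huv x y (hST hxy), if_neg]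
      rintro rfl
      exact hpS hxy
    simpa using huv p.1 p.2 hp

/-! ### The layer recursion -/

section Layer

variable {𝕜 : Type*} [Field 𝕜] {A B : Type*}

/-- What remains of `S` after deleting `J` from the side `B`, with the two sides exchanged. -/
def remainder (S : Set (A × B)) (J : Set B) : Set (↥Jᶜ × A) :=
  {p | (p.2, p.1.1) ∈ S}

/-- The function `g` records the layer of `S` next to `J`: the only neighbour of `x` in `J`
is `g x`, and there is none if `g x = none`. -/
def HasLayer (S : Set (A × B)) (J : Set B) (g : A → Option J) : Prop :=
  ∀ (x : A) (y : J), (x, y.1) ∈ S ↔ g x = some y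

theorem IsRooted.exists_hasLayer {S : Set (A × B)} {J : Set B} (h : IsRooted 𝕜 S J) :
    ∃ g : A → Option J, HasLayer S J g := by
  classical
  have huniq : ∀ (x : A) (y z : J), (x, y.1) ∈ S → (x, z.1) ∈ S → z = y := by
    intro x y z hy hz
    by_contra hne
    obtain ⟨u, v, hv, huv⟩ := h.exists_sol fun _ t => if t = y.1 then 1 else 0
    have h1 := huv x y hy
    have h2 := huv x z hz
    rw [hv _ y.2, if_pos rfl] at h1
    rw [hv _ z.2, if_neg fun e => hne (Subtype.ext e)] at h2
    exact one_ne_zero (h1.symm.trans h2)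
  refine ⟨fun x => if hx : ∃ y : J, (x, y.1) ∈ S then some hx.choose else none, fun x y => ?_⟩
  constructor
  · intro hy
    have hx : ∃ y : J, (x, y.1) ∈ S := ⟨y, hy⟩
    beta_reduce
    rw [dif_pos hx, huniq x y _ hy hx.choose_spec]
  · intro hy
    beta_reduce at hy
    split_ifs at hy with hx
    rw [← Option.some.inj hy]
    exact hx.choose_spec

/-- The layer determines `u` on its support, so the linear system is block triangular. -/
theorem isRooted_iff_isRooted_remainder {S : Set (A × B)} {J : Set B} {g : A → Option J}
    (hg : HasLayer S J g) :
    IsRooted 𝕜 S J ↔ IsRooted 𝕜 (remainder S J) {x | g x ≠ none} := by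
  classical
  have hsupp : ∀ x, g x ≠ none → ∃ y : J, (x, y.1) ∈ S := by
    intro x hx
    obtain ⟨y, hy⟩ := Option.ne_none_iff_exists'.1 hx
    exact ⟨y, (hg x y).2 hy⟩
  constructor
  · intro h
    constructor
    · intro f
      obtain ⟨u, v, hv, huv⟩ := h.exists_sol fun x y => if hy : y ∈ J then 0 else f ⟨y, hy⟩ x
      refine ⟨fun y => v y, u, fun x hx => ?_, fun y x hxy => ?_⟩
      · obtain ⟨y, hy⟩ := hsupp x hx
        simpa [hv _ y.2] using huv x y hy
      · have := huv x y hxy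
        rw [dif_neg y.2] at this
        rw [add_comm, this]
    · intro v u hu huv
      obtain ⟨hu', hv'⟩ := h.eq_zero u (fun y => if hy : y ∈ J then 0 else v ⟨y, hy⟩)
        (fun y hy => dif_pos hy) fun x y hxy => by
          by_cases hy : y ∈ J
          · rw [dif_pos hy, hu x, add_zero]
            simp [(hg x ⟨y, hy⟩).1 hxy]
          · rw [dif_neg hy, add_comm]
            exact huv ⟨y, hy⟩ x hxy
      refine ⟨funext fun y => ?_, hu'⟩
      have := congrFun hv' y.1
      rwa [dif_neg y.2] at this
  · intro h
    constructor
    · intro f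
      let c : A → 𝕜 := fun x => (g x).elim 0 fun y => f x y
      obtain ⟨v, u, hu, huv⟩ := h.exists_sol fun y x => f x y - c x
      refine ⟨fun x => u x + c x, fun y => if hy : y ∈ J then 0 else v ⟨y, hy⟩,
        fun y hy => dif_pos hy, fun x y hxy => ?_⟩
      by_cases hy : y ∈ J
      · have hx := (hg x ⟨y, hy⟩).1 hxy
        simp [hy, hu x (by simp [hx]), c, hx]
      · have := huv ⟨y, hy⟩ x hxy
        simp only [hy, dite_false]
        linear_combination this
    · intro u v hv huv
      obtain ⟨hv', hu'⟩ := h.eq_zero (fun y => v y) u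
        (fun x hx => by
          obtain ⟨y, hy⟩ := hsupp x hx
          simpa [hv _ y.2] using huv x y hy)
        fun y x hxy => by
          rw [add_comm]
          exact huv x y hxy
      refine ⟨hu', funext fun y => ?_⟩
      by_cases hy : y ∈ J
      · exact hv y hy
      · exact congrFun hv' ⟨y, hy⟩

variable (𝕜 A) in
/-- The number of subsets of `A × B` rooted at `J`. -/
noncomputable def rootedCount (J : Set B) : ℕ :=
  {S : Set (A × B) | IsRooted 𝕜 S J}.ncard

/-- Taking remainders is a bijection once the layer is fixed. -/
theorem ncard_isRooted_hasLayer (J : Set B) (g : A → Option J) :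
    {S : Set (A × B) | IsRooted 𝕜 S J ∧ HasLayer S J g}.ncard =
      rootedCount 𝕜 ↥Jᶜ {x | g x ≠ none} := by
  classical
  refine Set.ncard_congr (fun S _ => remainder S J) ?_ ?_ ?_
  · rintro S ⟨h, hg⟩
    exact (isRooted_iff_isRooted_remainder hg).1 h
  · rintro S T ⟨-, hS⟩ ⟨-, hT⟩ h
    ext ⟨x, y⟩
    by_cases hy : y ∈ J
    · exact (hS x ⟨y, hy⟩).trans (hT x ⟨y, hy⟩).symm
    · exact Set.ext_iff.1 h (⟨y, hy⟩, x)
  · intro R hR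
    let S : Set (A × B) := {p | if hy : p.2 ∈ J then g p.1 = some ⟨p.2, hy⟩
      else (⟨p.2, hy⟩, p.1) ∈ R}
    have hg : HasLayer S J g := fun x y => by simp [S]
    have hrem : remainder S J = R := by
      ext ⟨⟨y, hy⟩, x⟩
      have hy' : y ∉ J := hy
      simp [remainder, S, hy']
    refine ⟨S, ⟨(isRooted_iff_isRooted_remainder hg).2 ?_, hg⟩, hrem⟩
    rwa [hrem]

theorem rootedCount_eq_sum [Fintype A] [Fintype B] (J : Set B) [Fintype (A → Option J)] :
    rootedCount 𝕜 A J = ∑ g : A → Option J, rootedCount 𝕜 ↥Jᶜ {x | g x ≠ none} := by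
  have hunion : {S : Set (A × B) | IsRooted 𝕜 S J} =
      ⋃ g : A → Option J, {S : Set (A × B) | IsRooted 𝕜 S J ∧ HasLayer S J g} := by
    ext S
    simp only [Set.mem_ofPred_eq, Set.mem_iUnion]
    exact ⟨fun h => h.exists_hasLayer.imp fun g hg => ⟨h, hg⟩, fun ⟨g, h, _⟩ => h⟩
  rw [rootedCount, hunion, Set.ncard_iUnion_of_finite (fun _ => Set.toFinite _),
    finsum_eq_sum_of_fintype]
  · exact Finset.sum_congr rfl fun g _ => ncard_isRooted_hasLayer J g
  · intro g g' hne
    refine Set.disjoint_left.2 fun S hS hS' => hne (funext fun x => Option.ext fun y => ?_)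
    exact (hS.2 x y).symm.trans (hS'.2 x y)

end Layer

/-! ### Solving the recursion -/

/-- The sum over all `g : A → Option J` of `|supp g| * c ^ (|A| - |supp g|)`: for each `x` in the
support the sum factors over `A`, with a factor `|J|` at `x` and `|J| + c` elsewhere. -/
theorem sum_ncard_support_mul_pow {A J : Type*} [Fintype A] [DecidableEq A] [Fintype J] (c : ℕ) :
    ∑ g : A → Option J, {x | g x ≠ none}.ncard *
        c ^ (Fintype.card A - {x | g x ≠ none}.ncard) =
      Fintype.card A * (Fintype.card J * (Fintype.card J + c) ^ (Fintype.card A - 1)) := by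
  classical
  have hterm : ∀ g : A → Option J, {x | g x ≠ none}.ncard *
      c ^ (Fintype.card A - {x | g x ≠ none}.ncard) =
      ∑ x, ∏ z, if g z = none then (if z = x then 0 else c) else 1 := by
    intro g
    have h1 : {x | g x ≠ none}.ncard = (Finset.univ.filter fun x => g x ≠ none).card := by
      rw [← Set.ncard_coe_finset]
      simp
    have h2 : Fintype.card A - {x | g x ≠ none}.ncard =
        (Finset.univ.filter fun x => g x = none).card := by
      have := Finset.card_filter_add_card_filter_not (s := (Finset.univ : Finset A))
        (fun x => g x = none)
      rw [Finset.card_univ] at this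
      rw [h1]
      simp only [ne_eq]
      omega
    rw [h2, h1, ← smul_eq_mul, ← Finset.sum_const, Finset.sum_filter]
    refine Finset.sum_congr rfl fun x _ => ?_
    split_ifs with hx
    · rw [← Finset.prod_const, Finset.prod_filter]
      refine Finset.prod_congr rfl fun z _ => ?_
      split_ifs with h3 h4
      · exact absurd (h4 ▸ h3) hx
      · rfl
      · rfl
    · refine (Finset.prod_eq_zero (Finset.mem_univ x) ?_).symm
      simp [not_not.1 hx]
  have hprod : ∀ x : A, ∑ g : A → Option J,
      ∏ z, (if g z = none then (if z = x then 0 else c) else 1) =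
      Fintype.card J * (Fintype.card J + c) ^ (Fintype.card A - 1) := by
    intro x
    have := Finset.prod_univ_sum (fun _ : A => (Finset.univ : Finset (Option J)))
      (fun z o => if o = none then (if z = x then 0 else c) else 1)
    rw [Fintype.piFinset_univ] at this
    rw [← this, ← Finset.mul_prod_erase _ _ (Finset.mem_univ x)]
    congr 1
    · simp [Fintype.sum_option]
    · rw [Finset.prod_congr rfl (g := fun _ => Fintype.card J + c), Finset.prod_const,
        Finset.card_erase_of_mem (Finset.mem_univ x), Finset.card_univ]
      intro z hz
      simp [Fintype.sum_option, Finset.ne_of_mem_erase hz, add_comm]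
  rw [Finset.sum_congr rfl fun g _ => hterm g, Finset.sum_comm, Finset.sum_congr rfl
    fun x _ => hprod x, Finset.sum_const, Finset.card_univ, smul_eq_mul]

/-- Uniqueness fails without roots, because of the solution `u = 1`, `v = -1`. -/
theorem rootedCount_empty (𝕜 : Type*) [Field 𝕜] (A : Type*) {B : Type*} [Nonempty B] :
    rootedCount 𝕜 A (∅ : Set B) = 0 := by
  have : {S : Set (A × B) | IsRooted 𝕜 S ∅} = ∅ := by
    refine Set.eq_empty_of_forall_notMem fun S hS => ?_
    have := (hS.eq_zero 1 (-1) (by simp) (by simp)).2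
    exact one_ne_zero (neg_eq_zero.1 (congrFun this (Classical.arbitrary B)))
  rw [rootedCount, this, Set.ncard_empty]

theorem card_mul_rootedCount_of_isEmpty (𝕜 : Type*) [Field 𝕜] (A : Type*) [IsEmpty A]
    {B : Type*} [Fintype B] (J : Set B) :
    Fintype.card B * rootedCount 𝕜 A J = J.ncard * 0 ^ (Fintype.card B - J.ncard) := by
  classical
  by_cases hJ : J = Set.univ
  · have : {S : Set (A × B) | IsRooted 𝕜 S J} = {∅} := by
      ext S
      refine ⟨fun _ => Set.eq_empty_of_isEmpty S, fun _ => ⟨fun f => ⟨0, 0, by simp, isEmptyElim⟩,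
        fun u v hv _ => ⟨funext isEmptyElim, funext fun y => hv y ?_⟩⟩⟩
      simp [hJ]
    rw [rootedCount, this, hJ]
    simp [Set.ncard_univ]
  · have : {S : Set (A × B) | IsRooted 𝕜 S J} = ∅ := by
      refine Set.eq_empty_of_forall_notMem fun S hS => hJ (Set.eq_univ_of_forall fun y => ?_)
      have := (hS.eq_zero 0 (fun z => if z ∈ J then 0 else 1) (fun z hz => if_pos hz)
        isEmptyElim).2
      by_contra hy
      simpa [hy] using congrFun this y
    have hlt : J.ncard < Fintype.card B := by
      rw [← Nat.card_eq_fintype_card]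
      exact Set.ncard_lt_card hJ
    rw [rootedCount, this, Set.ncard_empty, zero_pow (by omega)]
    simp

/-- The induction step of `card_mul_rootedCount`, with the two sides in any universes. -/
theorem card_mul_rootedCount_step {𝕜 : Type*} [Field 𝕜] {A B : Type*} [Fintype A] [Nonempty A]
    [Fintype B] [Nonempty B] (J : Set B) [Fintype ↥Jᶜ]
    (ih : ∀ I : Set A, Fintype.card A * rootedCount 𝕜 ↥Jᶜ I =
      I.ncard * Fintype.card A ^ Fintype.card ↥Jᶜ *
        Fintype.card ↥Jᶜ ^ (Fintype.card A - I.ncard)) :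
    Fintype.card B * rootedCount 𝕜 A J =
      J.ncard * Fintype.card B ^ Fintype.card A * Fintype.card A ^ (Fintype.card B - J.ncard) := by
  classical
  have hA : 0 < Fintype.card A := Fintype.card_pos
  have hJ : Fintype.card J = J.ncard := by rw [← Nat.card_coe_set_eq, Nat.card_eq_fintype_card]
  have hJc : J.ncard + Fintype.card ↥Jᶜ = Fintype.card B := by
    rw [← Nat.card_eq_fintype_card, Nat.card_coe_set_eq, Set.ncard_add_ncard_compl,
      Nat.card_eq_fintype_card]
  have hsum : Fintype.card A * rootedCount 𝕜 A J = Fintype.card A *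
      (J.ncard * Fintype.card B ^ (Fintype.card A - 1) * Fintype.card A ^ Fintype.card ↥Jᶜ) := by
    have := sum_ncard_support_mul_pow (A := A) (J := J) (Fintype.card ↥Jᶜ)
    rw [hJ, hJc] at this
    rw [rootedCount_eq_sum, Finset.mul_sum, Finset.sum_congr rfl fun g _ => ih _, ← mul_assoc,
      ← this, Finset.sum_mul]
    refine Finset.sum_congr rfl fun g _ => ?_
    ring
  rw [Nat.eq_of_mul_eq_mul_left hA hsum, ← hJc, Nat.add_sub_cancel_left, hJc]
  obtain ⟨a, ha⟩ := Nat.exists_eq_succ_of_ne_zero hA.ne'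
  rw [ha, Nat.succ_sub_one, pow_succ]
  ring

theorem card_compl_lt {C : Type*} [Fintype C] {J : Set C} [Fintype ↥Jᶜ] (hJ : J.Nonempty) :
    Fintype.card ↥Jᶜ < Fintype.card C := by
  obtain ⟨y, hy⟩ := hJ
  exact Fintype.card_lt_of_injective_of_notMem _ Subtype.val_injective (b := y) (by simpa using hy)

/-- Both orders of the two sides are treated at once, since the recursion exchanges them and the
sides may live in different universes. -/
theorem card_mul_rootedCount_aux (𝕜 : Type*) [Field 𝕜] (N : ℕ) :
    ∀ (A : Type*) (B : Type*) [Fintype A] [Fintype B], Fintype.card A + Fintype.card B = N →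
      (Nonempty B → ∀ J : Set B, Fintype.card B * rootedCount 𝕜 A J = J.ncard *
        Fintype.card B ^ Fintype.card A * Fintype.card A ^ (Fintype.card B - J.ncard)) ∧
      (Nonempty A → ∀ I : Set A, Fintype.card A * rootedCount 𝕜 B I = I.ncard *
        Fintype.card A ^ Fintype.card B * Fintype.card B ^ (Fintype.card A - I.ncard)) := by
  classical
  induction N using Nat.strong_induction_on with
  | _ N ih =>
    intro A B _ _ hN
    constructor
    · intro hB J
      rcases J.eq_empty_or_nonempty with rfl | hJ
      · simp [rootedCount_empty]
      cases isEmpty_or_nonempty A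
      · simp [card_mul_rootedCount_of_isEmpty]
      · have := card_compl_lt hJ
        exact card_mul_rootedCount_step J ((ih _ (by omega) A ↥Jᶜ rfl).2 ‹_›)
    · intro hA I
      rcases I.eq_empty_or_nonempty with rfl | hI
      · simp [rootedCount_empty]
      cases isEmpty_or_nonempty B
      · simp [card_mul_rootedCount_of_isEmpty]
      · have := card_compl_lt hI
        exact card_mul_rootedCount_step I ((ih _ (by omega) ↥Iᶜ B rfl).1 ‹_›)

theorem card_mul_rootedCount (𝕜 : Type*) [Field 𝕜] (A : Type*) {B : Type*} [Fintype A]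
    [Fintype B] [Nonempty B] (J : Set B) :
    Fintype.card B * rootedCount 𝕜 A J = J.ncard *
      Fintype.card B ^ Fintype.card A * Fintype.card A ^ (Fintype.card B - J.ncard) :=
  (card_mul_rootedCount_aux 𝕜 _ A B rfl).1 ‹_› J

/-! ### Counting maximal good sets -/

section Count

variable (𝕜 : Type*) [RCLike 𝕜] (X Y : Type*) [Fintype X] [Fintype Y] [Nonempty X]

theorem ncard_isMaximalGood [Nonempty Y] :
    {S : Set (X × Y) | IsMaximalGood 𝕜 S}.ncard =
      Fintype.card X ^ (Fintype.card Y - 1) * Fintype.card Y ^ (Fintype.card X - 1) := by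
  have hY : 0 < Fintype.card Y := Fintype.card_pos
  obtain ⟨a, ha⟩ := Nat.exists_eq_succ_of_ne_zero (Fintype.card_pos (α := X)).ne'
  have hcount := card_mul_rootedCount 𝕜 X ({Classical.arbitrary Y} : Set Y)
  simp only [isMaximalGood_iff_isRooted _ (Classical.arbitrary Y)]
  refine Nat.eq_of_mul_eq_mul_left hY (hcount.trans ?_)
  rw [Set.ncard_singleton, ha, Nat.succ_sub_one, pow_succ]
  ring

variable {X Y} in
/-- Prescribing the neighbours of `y` prescribes the layer next to the root `y`. -/
theorem card_mul_ncard_isMaximalGood_of_section (y : Y) (I : Finset X) :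
    Fintype.card X * {S : Set (X × Y) | IsMaximalGood 𝕜 S ∧ ∀ x : X, (x, y) ∈ S ↔ x ∈ I}.ncard =
      I.card * Fintype.card X ^ (Fintype.card Y - 1) *
        (Fintype.card Y - 1) ^ (Fintype.card X - I.card) := by
  classical
  let g : X → Option ({y} : Set Y) := fun x => if x ∈ I then some ⟨y, rfl⟩ else none
  have hsupp : {x | g x ≠ none} = (I : Set X) := by
    ext x
    simp [g]
  have hset : {S : Set (X × Y) | IsMaximalGood 𝕜 S ∧ ∀ x : X, (x, y) ∈ S ↔ x ∈ I} =
      {S : Set (X × Y) | IsRooted 𝕜 S {y} ∧ HasLayer S {y} g} := by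
    ext S
    refine and_congr (isMaximalGood_iff_isRooted S y) ⟨fun h x z => ?_, fun h x => ?_⟩
    · obtain ⟨z, rfl⟩ := z
      simp [g, h x]
    · simpa [g] using h x ⟨y, rfl⟩
  have hcard : Fintype.card ↥({y} : Set Y)ᶜ = Fintype.card Y - 1 := by
    rw [Fintype.card_compl_set]
    simp
  rw [hset, ncard_isRooted_hasLayer, hsupp, card_mul_rootedCount, Set.ncard_coe_finset, hcard]

variable {X Y} in
theorem cast_ncard_isMaximalGood_of_section (y : Y) (I : Finset X) :
    ({S : Set (X × Y) | IsMaximalGood 𝕜 S ∧ ∀ x : X, (x, y) ∈ S ↔ x ∈ I}.ncard : ℚ) =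
      (I.card : ℚ) * (Fintype.card X : ℚ) ^ ((Fintype.card Y : ℤ) - 2) *
        ((Fintype.card Y : ℚ) - 1) ^ (Fintype.card X - I.card) := by
  have hX : (Fintype.card X : ℚ) ≠ 0 := by exact_mod_cast (Fintype.card_pos (α := X)).ne'
  have hY : 1 ≤ Fintype.card Y := Fintype.card_pos_iff.2 ⟨y⟩
  have h := congrArg (Nat.cast (R := ℚ)) (card_mul_ncard_isMaximalGood_of_section 𝕜 y I)
  push_cast [Nat.cast_sub hY] at h
  have hexp : (Fintype.card Y : ℤ) - 2 = ((Fintype.card Y - 1 : ℕ) : ℤ) - 1 := by omega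
  rw [hexp, zpow_sub_one₀ hX, zpow_natCast]
  refine mul_left_cancel₀ hX (h.trans ?_)
  field_simp

end Count

theorem IsGood.preimage_swap {𝕜 : Type*} [RCLike 𝕜] {X Y : Type*} {S : Set (X × Y)}
    (h : IsGood 𝕜 S) : IsGood 𝕜 (Prod.swap ⁻¹' S : Set (Y × X)) := by
  intro f
  obtain ⟨u, v, huv⟩ := h fun p => f ⟨p.1.swap, by simp⟩
  exact ⟨v, u, fun p => by simpa [add_comm] using huv ⟨p.1.swap, p.2⟩⟩

theorem IsMaximalGood.preimage_swap {𝕜 : Type*} [RCLike 𝕜] {X Y : Type*} {S : Set (X × Y)}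
    (h : IsMaximalGood 𝕜 S) : IsMaximalGood 𝕜 (Prod.swap ⁻¹' S : Set (Y × X)) :=
  ⟨h.prop.preimage_swap, fun _ hT hST p hp =>
    h.le_of_ge hT.preimage_swap (fun q hq => hST (by simpa using hq)) (by simpa using hp)⟩

theorem ncard_isMaximalGood_section_swap (𝕜 : Type*) [RCLike 𝕜] {X Y : Type*} (x : X)
    (J : Finset Y) :
    {S : Set (X × Y) | IsMaximalGood 𝕜 S ∧ ∀ y : Y, (x, y) ∈ S ↔ y ∈ J}.ncard =
      {S : Set (Y × X) | IsMaximalGood 𝕜 S ∧ ∀ y : Y, (y, x) ∈ S ↔ y ∈ J}.ncard := by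
  refine Set.ncard_congr (fun S _ => Prod.swap ⁻¹' S) (fun S hS => ⟨hS.1.preimage_swap, hS.2⟩)
    (fun S T _ _ h => Set.preimage_injective.2 Prod.swap_surjective h) fun S hS =>
    ⟨Prod.swap ⁻¹' S, ⟨hS.1.preimage_swap, hS.2⟩, ?_⟩
  ext p
  simp

/-! ### Spanning trees of the complete bipartite graph -/

section Tree

variable {X Y : Type*}

/-- The bipartite graph with parts `X` and `Y` and edge set `S`. -/
def bipartiteGraph (S : Set (X × Y)) : SimpleGraph (X ⊕ Y) where
  Adj
    | .inl x, .inr y => (x, y) ∈ S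
    | .inr y, .inl x => (x, y) ∈ S
    | _, _ => False
  symm := ⟨by rintro (x | y) (x' | y') h <;> exact h⟩
  loopless := ⟨by rintro (x | y) h <;> exact h⟩

theorem edgeSet_bipartiteGraph (S : Set (X × Y)) :
    (bipartiteGraph S).edgeSet = (fun p : X × Y => s(Sum.inl p.1, Sum.inr p.2)) '' S := by
  ext e
  induction e using Sym2.ind with
  | _ a b => rcases a with x | y <;> rcases b with x' | y' <;> simp [bipartiteGraph]

theorem ncard_edgeSet_bipartiteGraph (S : Set (X × Y)) :
    (bipartiteGraph S).edgeSet.ncard = S.ncard := by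
  rw [edgeSet_bipartiteGraph]
  refine Set.ncard_image_of_injective _ fun p q h => ?_
  simpa [Prod.ext_iff] using h

theorem connected_bipartiteGraph_iff (𝕜 : Type*) [Field 𝕜] (S : Set (X × Y)) (y₀ : Y) :
    (bipartiteGraph S).Connected ↔ ∀ (u : X → 𝕜) (v : Y → 𝕜), (∀ y ∈ ({y₀} : Set Y), v y = 0) →
      (∀ x y, (x, y) ∈ S → u x + v y = 0) → u = 0 ∧ v = 0 := by
  classical
  constructor
  · intro h u v hv huv
    -- The function equal to `u` on `X` and to `-v` on `Y` is constant along edges.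
    have hadj : ∀ a b, (bipartiteGraph S).Adj a b → Sum.elim u (-v) a = Sum.elim u (-v) b := by
      rintro (x | y) (x' | y') hab
      · exact False.elim hab
      · exact eq_neg_of_add_eq_zero_left (huv _ _ hab)
      · exact (eq_neg_of_add_eq_zero_left (huv _ _ hab)).symm
      · exact False.elim hab
    have hconst : ∀ a b, (bipartiteGraph S).Reachable a b →
        Sum.elim u (-v) a = Sum.elim u (-v) b := by
      rintro a b ⟨w⟩
      induction w with
      | nil => rfl
      | cons hab _ ih => exact (hadj _ _ hab).trans ih
    have hzero : ∀ a, Sum.elim u (-v) a = 0 := fun a => by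
      rw [hconst a (.inr y₀) (h.preconnected _ _)]
      simp [hv y₀ rfl]
    exact ⟨funext fun x => hzero (.inl x), funext fun y => neg_eq_zero.1 (hzero (.inr y))⟩
  · intro h
    -- The indicator of the complement of the component of `y₀` is constant along edges.
    let c : X ⊕ Y → 𝕜 := fun a => if (bipartiteGraph S).Reachable a (.inr y₀) then 0 else 1
    have hc : ∀ a, c a = 0 → (bipartiteGraph S).Reachable a (.inr y₀) := fun a ha => by
      by_contra hr
      simp [c, hr] at ha
    obtain ⟨hu, hv⟩ := h (fun x => c (.inl x)) (fun y => -c (.inr y))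
      (by simp [c]) fun x y hxy => by
        have hadj : (bipartiteGraph S).Adj (.inl x) (.inr y) := hxy
        have : (bipartiteGraph S).Reachable (.inl x) (.inr y₀) ↔
            (bipartiteGraph S).Reachable (.inr y) (.inr y₀) :=
          ⟨hadj.reachable.symm.trans, hadj.reachable.trans⟩
        simp [c, this]
    have hreach : ∀ a, (bipartiteGraph S).Reachable a (.inr y₀) := by
      rintro (x | y)
      · exact hc _ (congrFun hu x)
      · exact hc _ (neg_eq_zero.1 (congrFun hv y))
    have : Nonempty (X ⊕ Y) := ⟨.inr y₀⟩
    exact { preconnected := fun a b => (hreach a).trans (hreach b).symm }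

/-- The left-hand side of the linear system rooted at `{y₀}`. -/
def systemMap (𝕜 : Type*) [Field 𝕜] (S : Set (X × Y)) (y₀ : Y) :
    (X → 𝕜) × (Y → 𝕜) →ₗ[𝕜] (S → 𝕜) × 𝕜 where
  toFun w := (fun p => w.1 p.1.1 + w.2 p.1.2, w.2 y₀)
  map_add' w w' := by
    ext
    · simp [add_add_add_comm]
    · simp
  map_smul' c w := by
    ext
    · simp [mul_add]
    · simp

theorem systemMap_injective_iff (𝕜 : Type*) [Field 𝕜] (S : Set (X × Y)) (y₀ : Y) :
    Function.Injective (systemMap 𝕜 S y₀) ↔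
      ∀ (u : X → 𝕜) (v : Y → 𝕜), (∀ y ∈ ({y₀} : Set Y), v y = 0) →
        (∀ x y, (x, y) ∈ S → u x + v y = 0) → u = 0 ∧ v = 0 := by
  rw [injective_iff_map_eq_zero]
  constructor
  · intro h u v hv huv
    exact Prod.ext_iff.1 (h (u, v) (Prod.ext (funext fun p => huv _ _ p.2) (hv y₀ rfl)))
  · rintro h ⟨u, v⟩ hw
    obtain ⟨h1, h2⟩ := Prod.ext_iff.1 hw
    exact Prod.ext_iff.2 (h u v (by rintro y rfl; exact h2)
      fun x y hxy => congrFun h1 ⟨(x, y), hxy⟩)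

theorem systemMap_surjective_iff (𝕜 : Type*) [Field 𝕜] (S : Set (X × Y)) (y₀ : Y) :
    Function.Surjective (systemMap 𝕜 S y₀) ↔
      ∀ f : X → Y → 𝕜, ∃ (u : X → 𝕜) (v : Y → 𝕜), (∀ y ∈ ({y₀} : Set Y), v y = 0) ∧
        ∀ x y, (x, y) ∈ S → u x + v y = f x y := by
  classical
  constructor
  · intro h f
    obtain ⟨⟨u, v⟩, hw⟩ := h (fun p => f p.1.1 p.1.2, 0)
    obtain ⟨h1, h2⟩ := Prod.ext_iff.1 hw
    exact ⟨u, v, by rintro y rfl; exact h2, fun x y hxy => congrFun h1 ⟨(x, y), hxy⟩⟩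
  · rintro h ⟨f, c⟩
    obtain ⟨u, v, hv, huv⟩ := h fun x y => if hxy : (x, y) ∈ S then f ⟨(x, y), hxy⟩ else 0
    -- Shifting by the constant `c` prescribes the value at `y₀`.
    refine ⟨(fun x => u x - c, fun y => v y + c), Prod.ext (funext fun p => ?_) ?_⟩
    · have := huv p.1.1 p.1.2 p.2
      rw [dif_pos p.2] at this
      simp only [systemMap, LinearMap.coe_mk, AddHom.coe_mk]
      linear_combination this
    · simp [systemMap, hv y₀ rfl]

theorem isRooted_singleton_iff_isTree (𝕜 : Type*) [Field 𝕜] [Fintype X] [Fintype Y]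
    (S : Set (X × Y)) (y₀ : Y) : IsRooted 𝕜 S {y₀} ↔ (bipartiteGraph S).IsTree := by
  classical
  have hdom : Module.finrank 𝕜 ((X → 𝕜) × (Y → 𝕜)) = Nat.card (X ⊕ Y) := by
    simp
  have hcod : Module.finrank 𝕜 ((S → 𝕜) × 𝕜) = Nat.card (bipartiteGraph S).edgeSet + 1 := by
    rw [Nat.card_coe_set_eq, ncard_edgeSet_bipartiteGraph, ← Nat.card_coe_set_eq]
    simp
  rw [SimpleGraph.isTree_iff_connected_and_card, connected_bipartiteGraph_iff 𝕜 S y₀,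
    ← systemMap_injective_iff, ← hdom, ← hcod]
  constructor
  · intro h
    have hinj := (systemMap_injective_iff 𝕜 S y₀).2 h.eq_zero
    have hsurj := (systemMap_surjective_iff 𝕜 S y₀).2 h.exists_sol
    exact ⟨hinj, (LinearEquiv.ofBijective _ ⟨hinj, hsurj⟩).finrank_eq.symm⟩
  · rintro ⟨hinj, hcard⟩
    exact ⟨(systemMap_surjective_iff 𝕜 S y₀).1
      ((LinearMap.injective_iff_surjective_of_finrank_eq_finrank hcard.symm).1 hinj),
      (systemMap_injective_iff 𝕜 S y₀).1 hinj⟩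

theorem ncard_isMaximalGood_eq_ncard_isSpanningTree (𝕜 : Type*) [RCLike 𝕜] [Fintype X]
    [Fintype Y] [Nonempty X] [Nonempty Y] :
    {S : Set (X × Y) | IsMaximalGood 𝕜 S}.ncard =
      {T : SimpleGraph (X ⊕ Y) | IsSpanningTree (completeBipartiteGraph X Y) T}.ncard := by
  have hiff : ∀ S : Set (X × Y), IsMaximalGood 𝕜 S ↔ (bipartiteGraph S).IsTree := fun S =>
    (isMaximalGood_iff_isRooted S (Classical.arbitrary Y)).trans
      (isRooted_singleton_iff_isTree 𝕜 S _)
  refine Set.ncard_congr (fun S _ => bipartiteGraph S) ?_ ?_ ?_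
  · refine fun S hS => ⟨?_, (hiff S).1 hS⟩
    rintro (x | y) (x' | y') h
    · exact h.elim
    · simp
    · simp
    · exact h.elim
  · intro S T _ _ h
    ext ⟨x, y⟩
    exact iff_of_eq (congrArg (fun G : SimpleGraph (X ⊕ Y) => G.Adj (.inl x) (.inr y)) h)
  · rintro T ⟨hT, htree⟩
    have hgraph : bipartiteGraph {p : X × Y | T.Adj (.inl p.1) (.inr p.2)} = T := by
      ext a b
      rcases a with x | y <;> rcases b with x' | y'
      · exact ⟨False.elim, fun h => by simpa using hT h⟩
      · exact Iff.rfl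
      · exact T.adj_comm _ _
      · exact ⟨False.elim, fun h => by simpa using hT h⟩
    refine ⟨_, (hiff _).2 ?_, hgraph⟩
    rwa [hgraph]

end Tree

/-! ### The three counts -/

theorem mainTheorem2 (𝕜 : Type*) [RCLike 𝕜] (X Y : Type*) [Fintype X] [Fintype Y]
    [Nonempty X] [Nonempty Y] (m n : ℕ) (hm : Fintype.card X = m) (hn : Fintype.card Y = n) :
    ({S : Set (X × Y) | IsMaximalGood 𝕜 S}.ncard = m ^ (n - 1) * n ^ (m - 1) ∧
      {S : Set (X × Y) | IsMaximalGood 𝕜 S}.ncard =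
        {T : SimpleGraph (X ⊕ Y) | IsSpanningTree (completeBipartiteGraph X Y) T}.ncard) ∧
    (∀ (k : ℕ) (x : X) (J : Finset Y), 1 ≤ k → J.card = k →
      ({S : Set (X × Y) | IsMaximalGood 𝕜 S ∧ ∀ y : Y, (x, y) ∈ S ↔ y ∈ J}.ncard : ℚ) =
        (k : ℚ) * (n : ℚ) ^ ((m : ℤ) - 2) * ((m : ℚ) - 1) ^ (n - k)) ∧
    (∀ (k : ℕ) (y : Y) (I : Finset X), 1 ≤ k → I.card = k →
      ({S : Set (X × Y) | IsMaximalGood 𝕜 S ∧ ∀ x : X, (x, y) ∈ S ↔ x ∈ I}.ncard : ℚ) =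
        (k : ℚ) * (m : ℚ) ^ ((n : ℤ) - 2) * ((n : ℚ) - 1) ^ (m - k)) := by
  subst hm hn
  refine ⟨⟨ncard_isMaximalGood 𝕜 X Y, ncard_isMaximalGood_eq_ncard_isSpanningTree 𝕜⟩, ?_, ?_⟩
  · rintro _ x J - rfl
    rw [ncard_isMaximalGood_section_swap]
    exact cast_ncard_isMaximalGood_of_section 𝕜 x J
  · rintro _ y I - rfl
    exact cast_ncard_isMaximalGood_of_section 𝕜 y I
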